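/- Theorem 4 (CLT in WOT). Let $\mathcal H=L_2(\mathbb R^d)$ be the complex Hilbert space of functions square-integrable with respect to Lebesgue measure. For $a\in\mathbb R^d$ let $S_a\colon\mathcal H\to\mathcal H$ be the shift operator $(S_au)(x)=u(x+a)$, and for $u\in\mathcal H$ let $\rho[u]=|u\rangle\langle u|$ be the rank-one trace class operator $v\mapsto\langle u,v\rangle u$ (with $\langle\cdot,\cdot\rangle$ linear in the second argument). Let $u\in\mathcal H$, let $\xi_1,\xi_2,\dots$ be i.i.d. random vectors in $\mathbb R^d$ with finite second moments, zero mean and covariance matrix $\Sigma\in\mathbb R^{d\times d}$, and let $\eta\sim N(0,\Sigma)$ be a Gaussian random vector, possibly defined on another probability space. Then the random pure states $\rho[S_{\xi_1/\sqrt n}\cdots S_{\xi_n/\sqrt n}u]$ converge in distribution in the weak operator topology (WOT) to the random pure state $\rho[S_\eta u]$; in other words, for every bounded linear operator $A$ on $\mathcal H$ the (complex) random variables satisfy $$\operatorname{tr}\bigl(\rho[S_{\xi_1/\sqrt n}\cdots S_{\xi_n/\sqrt n}u]\,A\bigr)\xrightarrow[n\to\infty]{d}\operatorname{tr}\bigl(\rho[S_\eta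 u]\,A\bigr).$$ Moreover, for every bounded linear operator $A$ on $\mathcal H$ these random variables are integrable and $$\mathbb E\operatorname{tr}\bigl(\rho[S_{\xi_1/\sqrt n}\cdots S_{\xi_n/\sqrt n}u]\,A\bigr)\xrightarrow[n\to\infty]{}\mathbb E\operatorname{tr}\bigl(\rho[S_\eta u]\,A\bigr).$$ -/

import Mathlib

open MeasureTheory ProbabilityTheory Filter Topology
open scoped InnerProductSpace

noncomputable section

section TraceClass

variable {H : Type*} [NormedAddCommGroup H] [InnerProductSpace ℂ H] [CompleteSpace H]

/-- A bounded operator `T` is trace class (nuclear) if `∑ i, ⟪b i, |T| (b i)⟫ < ∞` for every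
Hilbert basis `b` of `H`, where `|T| = (T* T) ^ (1 / 2)`. -/
def IsTraceClass (T : H →L[ℂ] H) : Prop :=
  ∀ (w : Set H) (b : HilbertBasis w ℂ H), Summable fun i => ⟪b i, CFC.abs T (b i)⟫_ℂ

/-- The trace `∑ i, ⟪b i, T (b i)⟫`, computed in a fixed Hilbert basis `b` of `H` (for a trace class
operator the sum converges absolutely and does not depend on the basis). -/
def opTrace (T : H →L[ℂ] H) : ℂ :=
  ∑' i, ⟪(exists_hilbertBasis ℂ H).choose_spec.choose i,
    T ((exists_hilbertBasis ℂ H).choose_spec.choose i)⟫_ℂ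

variable (H) in
/-- The normal quantum states in the wide sense: the trace class operators on `H`. -/
def QState : Type _ := {T : H →L[ℂ] H // IsTraceClass T}

theorem isTraceClass_rankOne_self (u : H) : IsTraceClass (InnerProductSpace.rankOne ℂ u u) := by
  intro w b
  have hpos : 0 ≤ InnerProductSpace.rankOne ℂ u u :=
    (ContinuousLinearMap.nonneg_iff_isPositive _).2
      (InnerProductSpace.isPositive_rankOne_self u)
  rw [CFC.abs_of_nonneg _ hpos]
  refine (b.summable_inner_mul_inner u u).congr fun i => ?_
  simp [InnerProductSpace.rankOne_apply]

/-- The pure state `ρ[u] = |u⟩⟨u|`, that is, the operator `v ↦ ⟨u, v⟩ u`. -/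
def pureState (u : H) : QState H :=
  ⟨InnerProductSpace.rankOne ℂ u u, isTraceClass_rankOne_self u⟩

/-- The functional `ρ ↦ tr (ρ A)` given by a bounded operator `A`. -/
def QState.trMul (ρ : QState H) (A : H →L[ℂ] H) : ℂ := opTrace (ρ.1 ∘L A)

/-- On pure states the trace is the sum of the convergent diagonal series in every basis. -/
theorem hasSum_pureState_trMul (u : H) (A : H →L[ℂ] H) (w : Set H) (b : HilbertBasis w ℂ H) :
    HasSum (fun i => ⟪b i, ((pureState u).1 ∘L A) (b i)⟫_ℂ) ((pureState u).trMul A) := by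
  have key : ∀ (w : Set H) (b : HilbertBasis w ℂ H),
      HasSum (fun i => ⟪b i, ((pureState u).1 ∘L A) (b i)⟫_ℂ) ⟪A.adjoint u, u⟫_ℂ := by
    intro w b
    refine (b.hasSum_inner_mul_inner (A.adjoint u) u).congr_fun fun i => ?_
    simp [pureState, InnerProductSpace.rankOne_apply,
      ContinuousLinearMap.adjoint_inner_left]
  have h : (pureState u).trMul A = ⟪A.adjoint u, u⟫_ℂ := (key _ _).tsum_eq
  exact h ▸ key w b

/-- Random states `ρ n` on a probability space `(Ω, P)` converge in distribution in the weak operator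
topology to a random state `ρ'` on `(Ω', P')`: for every bounded operator `A` the complex random
variables `tr (ρ n A)` converge in distribution to `tr (ρ' A)`. -/
def TendstoInDistributionWOT {Ω Ω' : Type*} [MeasurableSpace Ω] [MeasurableSpace Ω']
    (ρ : ℕ → Ω → QState H) (ρ' : Ω' → QState H)
    (P : Measure Ω) [IsProbabilityMeasure P] (P' : Measure Ω') [IsProbabilityMeasure P'] : Prop :=
  ∀ A : H →L[ℂ] H,
    TendstoInDistribution (fun n ω => (ρ n ω).trMul A) atTop (fun ω => (ρ' ω).trMul A)
      (fun _ => P) P'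

end TraceClass

section Shift

/-- The Hilbert space `L²(ℝᵈ)` of complex functions, with respect to Lebesgue measure. -/
abbrev L2Space (d : ℕ) : Type :=
  Lp ℂ 2 (volume : Measure (EuclideanSpace ℝ (Fin d)))

/-- The shift operator `(S_a u)(x) = u (x + a)` on `L²(ℝᵈ)`. -/
def shiftOp {d : ℕ} (a : EuclideanSpace ℝ (Fin d)) : L2Space d →L[ℂ] L2Space d :=
  (Lp.compMeasurePreservingₗᵢ ℂ (fun x => x + a)
    (measurePreserving_add_right volume a)).toContinuousLinearMap

/-- The vector `S_{x₀/√n} S_{x₁/√n} ⋯ S_{xₙ₋₁/√n} u`. -/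
def shiftProd {d : ℕ} (x : ℕ → EuclideanSpace ℝ (Fin d)) (n : ℕ) (u : L2Space d) : L2Space d :=
  (List.ofFn fun k : Fin n => shiftOp ((Real.sqrt n)⁻¹ • x k)).prod u

end Shift

end

/-! Shifts compose additively, S_a S_b = S_{a+b}, so the random product is a single shift by the
normalized sum (`shiftProd_eq`). Its trace against A is ⟪S_a u, A S_a u⟫ (`trMul_pureState`), a
fixed function of the shift a: bounded because shifts are isometries, continuous because translation
is strongly continuous on L². The operator statement thus reduces to the CLT in ℝᵈ: continuous
mapping gives convergence in law, and testing weak convergence on this bounded function gives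
convergence of expectations. The CLT itself follows from the real one by Cramér–Wold. -/

section CramerWold

variable {E : Type*} [NormedAddCommGroup E] [InnerProductSpace ℝ E] [MeasurableSpace E]
  [BorelSpace E] [SecondCountableTopology E]

theorem charFun_map_eq_charFun_map_inner {Ω : Type*} [MeasurableSpace Ω] {P : Measure Ω}
    {X : Ω → E} (hX : AEMeasurable X P) (t : E) :
    charFun (P.map X) t = charFun (P.map fun ω => ⟪X ω, t⟫_ℝ) 1 := by
  rw [charFun_apply, charFun_apply_real, integral_map hX (by fun_prop),
    integral_map (by fun_prop) (by fun_prop)]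
  simp

/-- **Cramér–Wold**: convergence in distribution of all one-dimensional projections implies
convergence in distribution. -/
theorem tendstoInDistribution_of_forall_inner [FiniteDimensional ℝ E] {Ω Ω' : Type*}
    [MeasurableSpace Ω] [MeasurableSpace Ω'] {P : Measure Ω} [IsProbabilityMeasure P]
    {P' : Measure Ω'} [IsProbabilityMeasure P'] {X : ℕ → Ω → E} {Y : Ω' → E}
    (hX : ∀ n, AEMeasurable (X n) P) (hY : AEMeasurable Y P')
    (h : ∀ t : E, TendstoInDistribution (fun n ω => ⟪X n ω, t⟫_ℝ) atTop (fun ω => ⟪Y ω, t⟫_ℝ)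
      (fun _ => P) P') :
    TendstoInDistribution X atTop Y (fun _ => P) P' where
  forall_aemeasurable := hX
  aemeasurable_limit := hY
  tendsto := by
    -- Lévy's continuity theorem, used in both directions: on E at t, and on ℝ at 1.
    refine ProbabilityMeasure.tendsto_iff_tendsto_charFun.2 fun t => ?_
    simpa [charFun_map_eq_charFun_map_inner (hX _) t, charFun_map_eq_charFun_map_inner hY t] using
      ProbabilityMeasure.tendsto_iff_tendsto_charFun.1 (h t).tendsto 1

end CramerWold

section MultivariateCLT

variable {ι : Type*} [Fintype ι] {Ω : Type*} [MeasurableSpace Ω] {P : Measure Ω}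
  [IsProbabilityMeasure P] {X : Ω → EuclideanSpace ℝ ι} {S : Matrix ι ι ℝ}

theorem MeasureTheory.MemLp.euclideanSpace_apply {μ : Measure Ω} (hX : MemLp X 2 μ) (i : ι) :
    MemLp (fun ω => X ω i) 2 μ :=
  (EuclideanSpace.proj (𝕜 := ℝ) i).comp_memLp' hX

theorem variance_inner_eq_dotProduct_mulVec (hX : MemLp X 2 P)
    (hcov : ∀ i j, cov[fun ω => X ω i, fun ω => X ω j; P] = S i j) (t : EuclideanSpace ℝ ι) :
    Var[fun ω => ⟪X ω, t⟫_ℝ; P] = t ⬝ᵥ S.mulVec t := by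
  have h : (fun ω => ⟪X ω, t⟫_ℝ) = fun ω => ∑ i, t i * X ω i := by
    ext ω
    simp [PiLp.inner_apply]
  rw [h, variance_fun_sum fun i => (hX.euclideanSpace_apply i).const_mul _]
  simp only [covariance_const_mul_left, covariance_const_mul_right, hcov, dotProduct,
    Matrix.mulVec, Finset.mul_sum]
  refine Finset.sum_congr rfl fun i _ => Finset.sum_congr rfl fun j _ => ?_
  ring

/-- The quadratic form of S is a variance. The covariance formula for `multivariateGaussian`
requires this positivity. -/
theorem posSemidef_of_covariance_eq (hX : MemLp X 2 P)
    (hcov : ∀ i j, cov[fun ω => X ω i, fun ω => X ω j; P] = S i j) : S.PosSemidef := by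
  refine Matrix.PosSemidef.of_dotProduct_mulVec_nonneg ?_ fun x => ?_
  · ext i j
    simp [← hcov, covariance_comm]
  · simpa using (variance_inner_eq_dotProduct_mulVec hX hcov (WithLp.toLp 2 x)) ▸
      variance_nonneg (fun ω => ⟪X ω, WithLp.toLp 2 x⟫_ℝ) P

theorem hasLaw_inner_of_hasLaw_multivariateGaussian [DecidableEq ι] {μ : Measure Ω}
    {Y : Ω → EuclideanSpace ℝ ι}
    (hS : S.PosSemidef) (hY : HasLaw Y (multivariateGaussian 0 S) μ) (t : EuclideanSpace ℝ ι) :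
    HasLaw (fun ω => ⟪Y ω, t⟫_ℝ) (gaussianReal 0 (t ⬝ᵥ S.mulVec t).toNNReal) μ where
  aemeasurable := by
    have := hY.aemeasurable
    fun_prop
  map_eq := by
    have hmap : μ.map (fun ω => ⟪Y ω, t⟫_ℝ) =
        (multivariateGaussian 0 S).map (innerSL ℝ t) := by
      rw [← hY.map_eq, AEMeasurable.map_map_of_aemeasurable (by fun_prop) hY.aemeasurable]
      simp [Function.comp_def, real_inner_comm]
    have hmean : ∫ x, innerSL ℝ t x ∂multivariateGaussian 0 S = 0 := by
      have := (innerSL ℝ t).integral_comp_id_comm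
        (IsGaussian.integrable_id (μ := multivariateGaussian 0 S))
      rwa [integral_id_multivariateGaussian, map_zero] at this
    -- A linear functional of a Gaussian is real Gaussian, so only its mean and variance need
    -- matching.
    rw [hmap, IsGaussian.map_eq_gaussianReal, hmean]
    congr
    have hL : MemLp (id : EuclideanSpace ℝ ι → _) 2 (multivariateGaussian 0 S) :=
      IsGaussian.memLp_two_id
    have := variance_inner_eq_dotProduct_mulVec hL
      (fun i j => covariance_eval_multivariateGaussian hS i j) t
    rw [← this]
    simp [real_inner_comm]

/-- **Central limit theorem** in finite dimension. -/
theorem tendstoInDistribution_inv_sqrt_smul_sum [DecidableEq ι] {Ω' : Type*} [MeasurableSpace Ω']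
    {P' : Measure Ω'} [IsProbabilityMeasure P'] {ξ : ℕ → Ω → EuclideanSpace ℝ ι}
    {η : Ω' → EuclideanSpace ℝ ι}
    (hindep : iIndepFun ξ P) (hident : ∀ k, IdentDistrib (ξ k) (ξ 0) P P)
    (hL2 : MemLp (ξ 0) 2 P) (hmean : ∫ ω, ξ 0 ω ∂P = 0)
    (hcov : ∀ i j, cov[fun ω => ξ 0 ω i, fun ω => ξ 0 ω j; P] = S i j)
    (hη : HasLaw η (multivariateGaussian 0 S) P') :
    TendstoInDistribution (fun (n : ℕ) ω => (Real.sqrt n)⁻¹ • ∑ k ∈ Finset.range n, ξ k ω) atTop η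
      (fun _ => P) P' := by
  have hm k : AEMeasurable (ξ k) P := (hident k).aemeasurable_fst
  refine tendstoInDistribution_of_forall_inner (fun n => by fun_prop) hη.aemeasurable fun t => ?_
  have hlaw := hasLaw_inner_of_hasLaw_multivariateGaussian
    (posSemidef_of_covariance_eq hL2 hcov) hη t
  rw [← variance_inner_eq_dotProduct_mulVec hL2 hcov t] at hlaw
  -- The real CLT subtracts the mean; this removes that term.
  have hint : ∫ ω, ⟪ξ 0 ω, t⟫_ℝ ∂P = 0 := by
    have := integral_inner (𝕜 := ℝ) (hL2.integrable one_le_two) t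
    simpa [real_inner_comm, hmean] using this
  have hproj : Measurable fun x : EuclideanSpace ℝ ι => ⟪x, t⟫_ℝ := by fun_prop
  have := tendstoInDistribution_inv_sqrt_mul_sum_sub (X := fun k ω => ⟪ξ k ω, t⟫_ℝ) hlaw
    (hL2.inner_const t) (hindep.comp (fun _ x => ⟪x, t⟫_ℝ) fun _ => hproj)
    fun k => (hident k).comp hproj
  simpa [hint, sum_inner, real_inner_smul_left] using this

end MultivariateCLT

section ContinuousMapping

variable {Ω Ω' E : Type*} [MeasurableSpace Ω] [MeasurableSpace Ω'] {P : Measure Ω}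
  [IsProbabilityMeasure P] {P' : Measure Ω'} [IsProbabilityMeasure P'] [TopologicalSpace E]
  [MeasurableSpace E] [OpensMeasurableSpace E]

theorem MeasureTheory.TendstoInDistribution.tendsto_integral_comp {X : ℕ → Ω → E} {Y : Ω' → E}
    (h : TendstoInDistribution X atTop Y (fun _ => P) P') (f : BoundedContinuousFunction E ℂ) :
    Tendsto (fun n => ∫ ω, f (X n ω) ∂P) atTop (𝓝 (∫ ω, f (Y ω) ∂P')) := by
  have := (ProbabilityMeasure.tendsto_iff_forall_integral_rclike_tendsto ℂ).1 h.tendsto f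
  have hf : Measurable f := f.continuous.measurable
  simpa [integral_map (h.forall_aemeasurable _) hf.aestronglyMeasurable,
    integral_map h.aemeasurable_limit hf.aestronglyMeasurable] using this

theorem BoundedContinuousFunction.integrable_comp {X : Ω → E} (hX : AEMeasurable X P)
    (f : BoundedContinuousFunction E ℂ) : Integrable (fun ω => f (X ω)) P :=
  .of_bound (f.continuous.measurable.comp_aemeasurable hX).aestronglyMeasurable ‖f‖
    (ae_of_all _ fun _ => f.norm_coe_le_norm _)

end ContinuousMapping

section ShiftedStates

/-- Parseval's identity for A* u and u. -/
theorem trMul_pureState {H : Type*} [NormedAddCommGroup H] [InnerProductSpace ℂ H]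
    [CompleteSpace H] (u : H) (A : H →L[ℂ] H) : (pureState u).trMul A = ⟪u, A u⟫_ℂ := by
  obtain ⟨w, b, -⟩ := exists_hilbertBasis ℂ H
  refine (hasSum_pureState_trMul u A w b).unique ?_
  rw [← ContinuousLinearMap.adjoint_inner_left]
  refine (b.hasSum_inner_mul_inner (A.adjoint u) u).congr_fun fun i => ?_
  simp [pureState, InnerProductSpace.rankOne_apply, ContinuousLinearMap.adjoint_inner_left]

variable {d : ℕ}

theorem norm_shiftOp_apply (a : EuclideanSpace ℝ (Fin d)) (u : L2Space d) :
    ‖shiftOp a u‖ = ‖u‖ :=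
  LinearIsometry.norm_map _ u

theorem shiftOp_zero : shiftOp (0 : EuclideanSpace ℝ (Fin d)) = 1 := by
  ext1 u
  refine Eq.trans ?_ (Lp.compMeasurePreserving_id_apply u)
  simp only [shiftOp, add_zero]
  rfl

theorem shiftOp_mul_shiftOp (a b : EuclideanSpace ℝ (Fin d)) :
    shiftOp a * shiftOp b = shiftOp (a + b) := by
  ext1 u
  refine (Lp.compMeasurePreserving_comp_apply u (measurePreserving_add_right volume b)
    (measurePreserving_add_right volume a)).symm.trans ?_
  simp only [shiftOp, Function.comp_def, add_assoc]
  rfl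

theorem prod_map_shiftOp (l : List (EuclideanSpace ℝ (Fin d))) :
    (l.map shiftOp).prod = shiftOp l.sum := by
  induction l with
  | nil => simp [shiftOp_zero]
  | cons a l ih => simp [ih, shiftOp_mul_shiftOp]

/-- For n = 0 both sides are u, the sum being empty. -/
theorem shiftProd_eq (x : ℕ → EuclideanSpace ℝ (Fin d)) (n : ℕ) (u : L2Space d) :
    shiftProd x n u = shiftOp ((Real.sqrt n)⁻¹ • ∑ k ∈ Finset.range n, x k) u := by
  have h : (List.ofFn fun k : Fin n => shiftOp ((Real.sqrt n)⁻¹ • x k)) =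
      (List.ofFn fun k : Fin n => (Real.sqrt n)⁻¹ • x k).map shiftOp := by
    rw [List.map_ofFn]
    rfl
  rw [shiftProd, h, prod_map_shiftOp, List.sum_ofFn, Finset.smul_sum,
    Finset.sum_range fun k => (Real.sqrt n)⁻¹ • x k]

theorem continuous_shiftOp_apply (u : L2Space d) :
    Continuous fun a : EuclideanSpace ℝ (Fin d) => shiftOp a u := by
  let g : EuclideanSpace ℝ (Fin d) → C(EuclideanSpace ℝ (Fin d), EuclideanSpace ℝ (Fin d)) :=
    fun a => ⟨fun x => x + a, by fun_prop⟩
  have hg : Continuous g := ContinuousMap.continuous_of_continuous_uncurry _ (by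
    change Continuous fun p : EuclideanSpace ℝ (Fin d) × EuclideanSpace ℝ (Fin d) => p.2 + p.1
    fun_prop)
  -- Strong continuity needs a finite exponent, here 2 ≠ ∞.
  exact (continuous_const (y := u)).compMeasurePreservingLp hg
    (fun a => measurePreserving_add_right volume a) ENNReal.ofNat_ne_top

/-- The matrix element `a ↦ ⟪S_a u, A S_a u⟫` as a bounded continuous function of the shift. -/
noncomputable def shiftMatrixElement (u : L2Space d) (A : L2Space d →L[ℂ] L2Space d) :
    BoundedContinuousFunction (EuclideanSpace ℝ (Fin d)) ℂ :=
  .ofNormedAddCommGroup (fun a => ⟪shiftOp a u, A (shiftOp a u)⟫_ℂ)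
    ((continuous_shiftOp_apply u).inner (A.continuous.comp (continuous_shiftOp_apply u)))
    (‖u‖ * (‖A‖ * ‖u‖)) fun a => by
      refine (norm_inner_le_norm _ _).trans ?_
      rw [norm_shiftOp_apply]
      gcongr
      exact (A.le_opNorm _).trans_eq (by rw [norm_shiftOp_apply])

theorem trMul_pureState_shiftOp (u : L2Space d) (A : L2Space d →L[ℂ] L2Space d)
    (a : EuclideanSpace ℝ (Fin d)) :
    (pureState (shiftOp a u)).trMul A = shiftMatrixElement u A a :=
  trMul_pureState _ _

end ShiftedStates

theorem theorem4 {d : ℕ} {Ω Ω' : Type*} [MeasurableSpace Ω] [MeasurableSpace Ω']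
    (P : Measure Ω) [IsProbabilityMeasure P] (P' : Measure Ω') [IsProbabilityMeasure P']
    (u : L2Space d) (S : Matrix (Fin d) (Fin d) ℝ)
    (ξ : ℕ → Ω → EuclideanSpace ℝ (Fin d)) (η : Ω' → EuclideanSpace ℝ (Fin d))
    (hindep : iIndepFun ξ P) (hident : ∀ k, IdentDistrib (ξ k) (ξ 0) P P)
    (hL2 : MemLp (ξ 0) 2 P) (hmean : ∫ ω, ξ 0 ω ∂P = 0)
    (hcov : ∀ i j, cov[fun ω => ξ 0 ω i, fun ω => ξ 0 ω j; P] = S i j)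
    (hη : HasLaw η (multivariateGaussian 0 S) P') :
    TendstoInDistributionWOT
      (fun n ω => pureState (shiftProd (fun k => ξ k ω) n u))
      (fun ω => pureState (shiftOp (η ω) u)) P P' ∧
    ∀ A : L2Space d →L[ℂ] L2Space d,
      (∀ n, Integrable (fun ω => (pureState (shiftProd (fun k => ξ k ω) n u)).trMul A) P) ∧
      Integrable (fun ω => (pureState (shiftOp (η ω) u)).trMul A) P' ∧
      Tendsto (fun n : ℕ => ∫ ω, (pureState (shiftProd (fun k => ξ k ω) n u)).trMul A ∂P) atTop
        (𝓝 (∫ ω, (pureState (shiftOp (η ω) u)).trMul A ∂P')) := by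
  have hclt := tendstoInDistribution_inv_sqrt_smul_sum hindep hident hL2 hmean hcov hη
  simp only [TendstoInDistributionWOT, shiftProd_eq, trMul_pureState_shiftOp]
  exact ⟨fun A => hclt.continuous_comp (shiftMatrixElement u A).continuous, fun A =>
    ⟨fun n => (shiftMatrixElement u A).integrable_comp (hclt.forall_aemeasurable n),
      (shiftMatrixElement u A).integrable_comp hη.aemeasurable,
      hclt.tendsto_integral_comp (shiftMatrixElement u A)⟩⟩
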